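/- Let $ABC$ be a nondegenerate triangle in the Euclidean plane with circumcircle $\Omega$. Let $P \neq P'$ be isogonal conjugates with respect to $ABC$, neither lying on a side line of $ABC$; that is, at each vertex of the triangle, the lines joining that vertex to $P$ and to $P'$ are reflections of one another in the angle bisector. By a conic we mean a nondegenerate conic. Let $\mathcal H$ be a conic through $A, B, C, P, P'$, and let $D \neq A, B, C$ be a common point of $\Omega$ and $\mathcal H$. Let $D'$ be the second intersection of $\Omega$ with the line through $D$ parallel to $PP'$ (with $D' = D$ if this line is tangent to $\Omega$), and suppose $D' \neq A, B, C$. Let $\mathcal K$ be a conic through $A, B, C, D', P$, and suppose that $\mathcal K$ is an ellipse or a hyperbola (not a parabola), so that it has a center and two axes of symmetry, its major and minor axes (for a hyperbola, the transverse and conjugate axes), both regarded as full lines. Then $P$ lies on the major or the minor axis of $\mathcal K$ if and only if the line $PP'$ is tangent to $\mathcal K$ or passes through the center of $\mathcal K$. -/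

import Mathlib

noncomputable section

/-- The Euclidean plane `ℝ²`. -/
abbrev Plane : Type := EuclideanSpace ℝ (Fin 2)

/-- The standard orientation of the plane, used to measure directed angles. -/
instance planeOriented : Module.Oriented ℝ Plane (Fin 2) :=
  ⟨(EuclideanSpace.basisFun (Fin 2) ℝ).toBasis.orientation⟩

instance planeFact : Fact (Module.finrank ℝ Plane = 2) := ⟨by simp⟩

open EuclideanGeometry in
/-- `P` and `P'` are isogonal conjugates in the triangle `ABC`: neither lies on a side line, and at
each vertex the lines to `P` and to `P'` are reflections of one another in the angle bisector.
The latter says, at `A`, that the directed angle from `AB` to `AP` equals the directed angle from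
`AP'` to `AC` modulo `180°`; the angle `∡` of Mathlib is taken modulo `360°`, so that equality
modulo `180°` is equality of the doubles. -/
structure IsIsogonalConjugate (A B C P P' : Plane) : Prop where
  left_not_mem_AB : P ∉ line[ℝ, A, B]
  left_not_mem_BC : P ∉ line[ℝ, B, C]
  left_not_mem_CA : P ∉ line[ℝ, C, A]
  right_not_mem_AB : P' ∉ line[ℝ, A, B]
  right_not_mem_BC : P' ∉ line[ℝ, B, C]
  right_not_mem_CA : P' ∉ line[ℝ, C, A]
  angle_A : (2 : ℤ) • ∡ B A P = (2 : ℤ) • ∡ P' A C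
  angle_B : (2 : ℤ) • ∡ C B P = (2 : ℤ) • ∡ P' B A
  angle_C : (2 : ℤ) • ∡ A C P = (2 : ℤ) • ∡ P' C B

/-- A (nondegenerate) conic, given by an equation
`a x² + 2 b x y + c y² + 2 d x + 2 e y + f = 0` whose symmetric `3 × 3` matrix is invertible. -/
structure Conic where
  a : ℝ
  b : ℝ
  c : ℝ
  d : ℝ
  e : ℝ
  f : ℝ
  nondegenerate : (!![a, b, d; b, c, e; d, e, f] : Matrix (Fin 3) (Fin 3) ℝ).det ≠ 0

namespace Conic

/-- The left-hand side of the equation of the conic. -/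
def eqn (K : Conic) (X : Plane) : ℝ :=
  K.a * X 0 ^ 2 + 2 * K.b * X 0 * X 1 + K.c * X 1 ^ 2 + 2 * K.d * X 0 + 2 * K.e * X 1 + K.f

/-- `X ∈ K`: the point `X` lies on the conic `K`. -/
instance : Membership Plane Conic := ⟨fun K X => K.eqn X = 0⟩

/-- The symmetric `2 × 2` matrix of the quadratic part of the equation. -/
def quadPart (K : Conic) : Matrix (Fin 2) (Fin 2) ℝ := !![K.a, K.b; K.b, K.c]

/-- Half the gradient of `K.eqn` at `X`. -/
def halfGrad (K : Conic) (X : Plane) : Plane :=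
  !₂[K.a * X 0 + K.b * X 1 + K.d, K.b * X 0 + K.c * X 1 + K.e]

/-- The conic is central, that is, an ellipse or a hyperbola and not a parabola. -/
def IsCentral (K : Conic) : Prop := K.quadPart.det ≠ 0

/-- `O` is a center of the conic: the gradient of the equation vanishes there; equivalently, the
equation is invariant under the reflection in the point `O`. A nondegenerate conic has exactly one
center if it is an ellipse or a hyperbola, and none if it is a parabola. -/
def IsCenter (K : Conic) (O : Plane) : Prop := K.halfGrad O = 0

/-- `l` is a principal axis of the conic: a line through the center in the direction of an
eigenvector of the quadratic part. An ellipse that is not a circle has exactly two, its major and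
its minor axis; likewise a hyperbola, where these are the transverse and the conjugate axis. -/
def IsPrincipalAxis (K : Conic) (l : AffineSubspace ℝ Plane) : Prop :=
  ∃ (O v : Plane) (r : ℝ), K.IsCenter O ∧
    Module.End.HasEigenvector (Matrix.toEuclideanLin K.quadPart) r v ∧
    l = AffineSubspace.mk' O (Submodule.span ℝ {v})

/-- The tangent line of the conic at one of its points `Q`: the line through `Q` orthogonal to
the gradient of the equation at `Q` (which is nonzero, as the conic is nondegenerate). -/
def tangentLine (K : Conic) (Q : Plane) : AffineSubspace ℝ Plane :=
  AffineSubspace.mk' Q (Submodule.span ℝ {K.halfGrad Q})ᗮ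

/-- `l` is tangent to the conic (at some point of the conic). -/
def IsTangent (K : Conic) (l : AffineSubspace ℝ Plane) : Prop :=
  ∃ Q : Plane, Q ∈ K ∧ l = K.tangentLine Q

end Conic

end

open ComplexConjugate

/-! Everything reduces to one fact: `PP'` is parallel to an axis of `K`. Take `Ω` as the unit circle
in `ℂ` and write `a, b, c, d, d', p, r` for `A, B, C, D, D', P, P'`. A conic through `a, b, c, d`
restricts to `Ω` as a quartic, so its leading coefficient `α` satisfies `conj α = α * (a * b * c *
d)` and the conic is fixed by `α` and one coefficient `β` (`quadratic_vanishing_on_circle`).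
Isogonality lets `β` be computed for `H` from `p` and again from `r`; comparing gives `d (p - r) =
-abc (conj p - conj r)` (`direction_of_conic_isogonal`). The chord `DD'` gives `p - r = -d d' (conj
p - conj r)` (`direction_of_chord`). With `conj α = α * (a * b * c * d')` for `K`, these make `α (p
- r)²` real, which says that `p - r` is an eigendirection of `K`. Then `P` is on an axis iff `PP'`
is that axis, or is perpendicular to it and so tangent at the vertex `P`
(`Conic.exists_principalAxis_iff`). -/

theorem real_of_two_zsmul_oangle_eq {x y u v : Plane}
    (h : (2 : ℤ) • planeOriented.positiveOrientation.oangle x y =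
      (2 : ℤ) • planeOriented.positiveOrientation.oangle u v) :
    (x 0 * y 1 - x 1 * y 0) * (u 0 * v 0 + u 1 * v 1) =
      (x 0 * y 0 + x 1 * y 1) * (u 0 * v 1 - u 1 * v 0) := by
  set o := planeOriented.positiveOrientation with ho
  have area (x y : Plane) : o.areaForm x y = x 0 * y 1 - x 1 * y 0 := by
    rw [o.areaForm_to_volumeForm,
      o.volumeForm_robust (EuclideanSpace.basisFun (Fin 2) ℝ) rfl]
    simp [Module.Basis.det_apply, Matrix.det_fin_two, Module.Basis.toMatrix_apply]
    ring
  have inn (x y : Plane) : inner ℝ x y = x 0 * y 0 + x 1 * y 1 := by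
    simp [PiLp.inner_apply, Fin.sum_univ_two]; ring
  have hc (x y : Plane) : x 0 * y 0 + x 1 * y 1 = ‖x‖ * ‖y‖ * (o.oangle x y).cos := by
    rw [← inn, o.inner_eq_norm_mul_norm_mul_cos_oangle]
  have hs (x y : Plane) : x 0 * y 1 - x 1 * y 0 = ‖x‖ * ‖y‖ * (o.oangle x y).sin := by
    by_cases hx : x = 0
    · simp [hx]
    by_cases hy : y = 0
    · simp [hy]
    rw [← area, Orientation.oangle, Real.Angle.sin_coe, Complex.sin_arg, o.norm_kahler]
    have h1 := norm_ne_zero_iff.2 hx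
    have h2 := norm_ne_zero_iff.2 hy
    simp [Orientation.kahler_apply_apply]
    field_simp
  rw [hs x y, hs u v, hc x y, hc u v]
  rcases Real.Angle.two_zsmul_eq_iff.1 h with h | h <;> rw [h] <;> simp <;> ring

/-- Equal angles modulo `π` make `(p - a)(r - a) / ((b - a)(c - a))` real; this is its equality with
its conjugate, cleared of denominators. -/
theorem angle_relation {A B C P P' : Plane}
    (h : (2 : ℤ) • EuclideanGeometry.oangle B A P = (2 : ℤ) • EuclideanGeometry.oangle P' A C)
    {z : Plane → ℂ} {o : Plane} {R : ℝ}
    (hz : ∀ X : Plane, z X = ⟨(X 0 - o 0) / R, (X 1 - o 1) / R⟩) :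
    conj (z B - z A) * (z P - z A) * (z P' - z A) * conj (z C - z A) =
      (z B - z A) * conj (z P - z A) * conj (z P' - z A) * (z C - z A) := by
  have := real_of_two_zsmul_oangle_eq h
  simp only [vsub_eq_sub, PiLp.sub_apply] at this
  simp only [hz, div_eq_mul_inv]
  generalize R⁻¹ = k
  apply Complex.ext <;>
    simp only [Complex.mul_re, Complex.mul_im, Complex.sub_re, Complex.sub_im, Complex.conj_re,
      Complex.conj_im]
  · ring
  · linear_combination 2 * k ^ 4 * this

/-! ### Algebra of isogonal conjugates -/

section Field
variable {F : Type*} [Field F]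

/-- Vieta's formulas by successive divided differences, which also covers `c₄ = 0`. -/
theorem quartic_coeff {x₁ x₂ x₃ x₄ c₀ c₁ c₂ c₃ c₄ : F}
    (h₁₂ : x₁ ≠ x₂) (h₁₃ : x₁ ≠ x₃) (h₁₄ : x₁ ≠ x₄) (h₂₃ : x₂ ≠ x₃) (h₂₄ : x₂ ≠ x₄) (h₃₄ : x₃ ≠ x₄)
    (h : ∀ x, x = x₁ ∨ x = x₂ ∨ x = x₃ ∨ x = x₄ →
      c₄ * x ^ 4 + c₃ * x ^ 3 + c₂ * x ^ 2 + c₁ * x + c₀ = 0) :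
    c₃ = -c₄ * (x₁ + x₂ + x₃ + x₄) ∧
    c₂ = c₄ * (x₁ * x₂ + x₁ * x₃ + x₁ * x₄ + x₂ * x₃ + x₂ * x₄ + x₃ * x₄) ∧
    c₁ = -c₄ * (x₁ * x₂ * x₃ + x₁ * x₂ * x₄ + x₁ * x₃ * x₄ + x₂ * x₃ * x₄) ∧
    c₀ = c₄ * (x₁ * x₂ * x₃ * x₄) := by
  have d1 (y) (hy : x₁ ≠ y) (h' : y = x₂ ∨ y = x₃ ∨ y = x₄) :
      c₄ * (x₁^3 + x₁^2*y + x₁*y^2 + y^3) + c₃ * (x₁^2 + x₁*y+y^2) + c₂ * (x₁+y) + c₁ = 0 := by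
    apply mul_left_cancel₀ (sub_ne_zero.2 hy)
    linear_combination h x₁ (.inl rfl) - h y (.inr h')
  have d2 (y) (hy : x₂ ≠ y) (hy1 : x₁ ≠ y) (h' : y = x₃ ∨ y = x₄) :
      c₄ * (x₁^2 + x₁*(x₂+y) + (x₂^2+x₂*y+y^2)) + c₃ * (x₁+x₂+y) + c₂ = 0 := by
    apply mul_left_cancel₀ (sub_ne_zero.2 hy)
    linear_combination d1 x₂ h₁₂ (.inl rfl) - d1 y hy1 (.inr h')
  have d3 : c₄ * (x₁ + x₂ + x₃ + x₄) + c₃ = 0 := by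
    apply mul_left_cancel₀ (sub_ne_zero.2 h₃₄)
    linear_combination d2 x₃ h₂₃ h₁₃ (.inl rfl) - d2 x₄ h₂₄ h₁₄ (.inr rfl)
  have e3 : c₃ = -c₄ * (x₁ + x₂ + x₃ + x₄) := by linear_combination d3
  have e2 : c₂ = c₄ * (x₁ * x₂ + x₁ * x₃ + x₁ * x₄ + x₂ * x₃ + x₂ * x₄ + x₃ * x₄) := by
    linear_combination d2 x₃ h₂₃ h₁₃ (.inl rfl) - (x₁+x₂+x₃) * e3
  have e1 : c₁ = -c₄ * (x₁ * x₂ * x₃ + x₁ * x₂ * x₄ + x₁ * x₃ * x₄ + x₂ * x₃ * x₄) := by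
    linear_combination d1 x₂ h₁₂ (.inl rfl) - (x₁^2+x₁*x₂+x₂^2) * e3 - (x₁+x₂) * e2
  refine ⟨e3, e2, e1, ?_⟩
  linear_combination h x₁ (.inl rfl) - x₁^3 * e3 - x₁^2*e2 - x₁*e1

/-- The condition on the lines `ap`, `ap'` at the vertex `a`, for `a`, `b`, `c` on the unit circle;
`x'` stands for the conjugate of `x`. -/
theorem isogonal_at_vertex {a b c a' b' c' p q r s : F}
    (ha : a * a' = 1) (hb : b * b' = 1) (hc : c * c' = 1) (hab : a ≠ b) (hac : a ≠ c)
    (h : (b' - a') * (p - a) * (r - a) * (c' - a') = (b - a) * (q - a') * (s - a') * (c - a)) :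
    (p - a) * (r - a) = b * c * ((a * q - 1) * (a * s - 1)) := by
  have h1 : a * b * (b' - a') = a - b := by linear_combination a * hb - b * ha
  have h2 : a * c * (c' - a') = a - c := by linear_combination a * hc - c * ha
  have h3 : a * (q - a') = a * q - 1 := by linear_combination -ha
  have h4 : a * (s - a') = a * s - 1 := by linear_combination -ha
  apply mul_left_cancel₀ (mul_ne_zero (sub_ne_zero.2 hab) (sub_ne_zero.2 hac))
  rw [← h3, ← h4]
  calc _ = (a * b * (b' - a')) * (a * c * (c' - a')) * ((p - a) * (r - a)) := by rw [h1, h2]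
    _ = _ := by linear_combination a ^ 2 * b * c * h

/-- The difference of the two vertex relations is divisible by `a - b`; the quotient is the first
identity. -/
theorem isogonal_sum {a b c p q r s : F} (hab : a ≠ b)
    (h₁ : (p - a) * (r - a) = b * c * ((a * q - 1) * (a * s - 1)))
    (h₂ : (p - b) * (r - b) = c * a * ((b * q - 1) * (b * s - 1))) :
    p + r + a * b * c * (q * s) = a + b + c ∧
      a * b * c * (q + s) + p * r = a * b + b * c + c * a := by
  have h : p + r + a * b * c * (q * s) = a + b + c := by
    apply mul_left_cancel₀ (sub_ne_zero.2 hab)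
    linear_combination h₂ - h₁
  exact ⟨h, by linear_combination h₁ + a * h⟩

theorem not_mem_circle_of_isogonal {a b c p q r s : F}
    (h₁ : p + r + a * b * c * (q * s) = a + b + c)
    (h₂ : a * b * c * (q + s) + p * r = a * b + b * c + c * a)
    (ha : p ≠ a) (hb : p ≠ b) (hc : p ≠ c) : p * q ≠ 1 := by
  intro h
  have : (p - a) * (p - b) * (p - c) = 0 := by
    linear_combination p ^ 2 * h₁ - p * h₂ +
      a * b * c * (1 - p * s) * h
  simp [sub_eq_zero, ha, hb, hc] at this

/-- The factor `1 - p * q` is what matters: it cancels against `β * (p * q - 1)` in the equation of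
the conic and leaves `β` in closed form. -/
theorem conic_isogonal_value {a b c d p q r s : F}
    (h₁ : p + r + a * b * c * (q * s) = a + b + c)
    (h₂ : a * b * c * (q + s) + p * r = a * b + b * c + c * a) :
    p ^ 2 - (a + b + c + d) * p + (a * b + a * c + a * d + b * c + b * d + c * d) -
      (a * b * c + a * b * d + a * c * d + b * c * d) * q + a * b * c * d * q ^ 2 =
    (1 - p * q) * (a * b * c * s + d * r) := by
  linear_combination (p - d) * h₁ + (d * q - 1) * h₂

end Field

/-! ### Conics in complex coordinates -/

/-- The values of a real quadratic polynomial at a point `p`, if it vanishes at four points of the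
unit circle. -/
theorem quadratic_vanishing_on_circle {a b c d : ℂ} {α β γ κ : ℂ}
    (hab : a ≠ b) (hac : a ≠ c) (had : a ≠ d) (hbc : b ≠ c) (hbd : b ≠ d) (hcd : c ≠ d)
    (h : ∀ x, x = a ∨ x = b ∨ x = c ∨ x = d → x * conj x = 1 ∧
      α * x ^ 2 + β * (x * conj x) + conj α * conj x ^ 2 + γ * x + conj γ * conj x + κ = 0)
    (p : ℂ) :
    conj α = α * (a * b * c * d) ∧
    α * p ^ 2 + β * (p * conj p) + conj α * conj p ^ 2 + γ * p + conj γ * conj p + κ =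
      β * (p * conj p - 1) + α * (p ^ 2 - (a + b + c + d) * p +
        (a * b + a * c + a * d + b * c + b * d + c * d) -
        (a * b * c + a * b * d + a * c * d + b * c * d) * conj p +
        a * b * c * d * conj p ^ 2) := by
  -- On the unit circle `conj x = 1 / x`, so `x ^ 2` times the equation is a quartic in `x`.
  obtain ⟨h3, h2, h1, h0⟩ := quartic_coeff (c₄ := α) (c₃ := γ) (c₂ := β + κ) (c₁ := conj γ)
    (c₀ := conj α) hab hac had hbc hbd hcd (by
      intro x hx
      obtain ⟨hx1, hx2⟩ := h x hx
      linear_combination x ^ 2 * hx2 -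
        (β * x ^ 2 + conj α * (x * conj x + 1) + conj γ * x) * hx1)
  exact ⟨h0, by linear_combination p * h3 + h2 + conj p * h1 + conj p ^ 2 * h0⟩

theorem Conic.eqn_eq_complex (K : Conic) {z : Plane → ℂ} {o : Plane} {R : ℝ} (hR : R ≠ 0)
    (hz : ∀ X : Plane, z X = ⟨(X 0 - o 0) / R, (X 1 - o 1) / R⟩) {α β : ℂ}
    (hα : α = ⟨R ^ 2 * (K.a - K.c) / 4, -(R ^ 2 * K.b / 2)⟩)
    (hβ : β = (R ^ 2 * (K.a + K.c) / 2 : ℝ)) :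
    ∃ γ κ : ℂ, ∀ X : Plane, (K.eqn X : ℂ) =
      α * z X ^ 2 + β * (z X * conj (z X)) + conj α * conj (z X) ^ 2 + γ * z X +
        conj γ * conj (z X) + κ := by
  -- Taylor expansion at `o`.
  refine ⟨⟨R * K.halfGrad o 0, -(R * K.halfGrad o 1)⟩, (K.eqn o : ℝ), fun X => ?_⟩
  obtain ⟨x, hx⟩ : ∃ x, x = (X 0 - o 0) / R := ⟨_, rfl⟩
  obtain ⟨y, hy⟩ : ∃ y, y = (X 1 - o 1) / R := ⟨_, rfl⟩
  have h0 : X 0 = o 0 + R * x := by rw [hx]; field_simp; ring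
  have h1 : X 1 = o 1 + R * y := by rw [hy]; field_simp; ring
  rw [hz, ← hx, ← hy, hα, hβ]
  simp only [pow_two]
  apply Complex.ext <;>
    simp only [Complex.mul_re, Complex.mul_im, Complex.add_re, Complex.add_im, Complex.conj_re,
      Complex.conj_im, Complex.ofReal_re, Complex.ofReal_im, Conic.eqn, Conic.halfGrad, h0, h1,
      Matrix.cons_val_zero, Matrix.cons_val_one]
  · ring
  · ring

/-- The case `α = 0` is that of a circle. -/
theorem Conic.complex_of_mem (K : Conic) {z : Plane → ℂ} {o : Plane} {R : ℝ} (hR : R ≠ 0)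
    (hz : ∀ X : Plane, z X = ⟨(X 0 - o 0) / R, (X 1 - o 1) / R⟩) {A B C D P : Plane}
    (hab : z A ≠ z B) (hac : z A ≠ z C) (had : z A ≠ z D) (hbc : z B ≠ z C) (hbd : z B ≠ z D)
    (hcd : z C ≠ z D) (hA : A ∈ K) (hB : B ∈ K) (hC : C ∈ K) (hD : D ∈ K) (hP : P ∈ K)
    (hA1 : z A * conj (z A) = 1) (hB1 : z B * conj (z B) = 1) (hC1 : z C * conj (z C) = 1)
    (hD1 : z D * conj (z D) = 1) (hP1 : z P * conj (z P) ≠ 1) :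
    ∃ α β : ℂ, α ≠ 0 ∧ α = ⟨R ^ 2 * (K.a - K.c) / 4, -(R ^ 2 * K.b / 2)⟩ ∧
      conj α = α * (z A * z B * z C * z D) ∧ ∀ X ∈ K,
      β * (z X * conj (z X) - 1) + α * (z X ^ 2 - (z A + z B + z C + z D) * z X +
        (z A * z B + z A * z C + z A * z D + z B * z C + z B * z D + z C * z D) -
        (z A * z B * z C + z A * z B * z D + z A * z C * z D + z B * z C * z D) * conj (z X) +
        z A * z B * z C * z D * conj (z X) ^ 2) = 0 := by
  obtain ⟨α, hα⟩ : ∃ α : ℂ, α = ⟨R ^ 2 * (K.a - K.c) / 4, -(R ^ 2 * K.b / 2)⟩ := ⟨_, rfl⟩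
  obtain ⟨β, hβ⟩ : ∃ β : ℂ, β = (R ^ 2 * (K.a + K.c) / 2 : ℝ) := ⟨_, rfl⟩
  obtain ⟨γ, κ, h⟩ := K.eqn_eq_complex hR hz hα hβ
  have key := quadratic_vanishing_on_circle (α := α) (β := β) (γ := γ) (κ := κ)
    hab hac had hbc hbd hcd (by
      have h' (X) (hX : X ∈ K) := (h X).symm.trans (by rw [show K.eqn X = 0 from hX, Complex.ofReal_zero])
      rintro x (rfl | rfl | rfl | rfl)
      exacts [⟨hA1, h' A hA⟩, ⟨hB1, h' B hB⟩, ⟨hC1, h' C hC⟩, ⟨hD1, h' D hD⟩])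
  have hmem : ∀ X ∈ K, _ := fun X (hX : K.eqn X = 0) => by
    have := (key (z X)).2
    rw [← h X, hX, Complex.ofReal_zero] at this
    exact this.symm
  refine ⟨α, β, fun h0 => K.nondegenerate ?_, hα, (key 0).1, hmem⟩
  -- With `α = 0`, the point `P` off the unit circle forces `β = 0`, so the quadratic part vanishes.
  have hβ0 : β = 0 := by
    have := hmem P hP
    simpa [h0, sub_eq_zero, hP1] using this
  rw [hβ, Complex.ofReal_eq_zero] at hβ0
  rw [h0, Complex.ext_iff] at hα
  simp [hR] at hα hβ0
  have hb : K.b = 0 := hα.2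
  have hac' : K.a - K.c = 0 := by simpa [hR] using hα.1.symm
  have ha : K.a = 0 := by linarith
  have hc : K.c = 0 := by linarith
  simp [Matrix.det_fin_three, ha, hb, hc]

/-! ### Centers, axes and tangents -/

namespace Conic

theorem hasEigenvector_iff (K : Conic) {v : Plane} {r : ℝ} :
    Module.End.HasEigenvector (Matrix.toEuclideanLin K.quadPart) r v ↔
      (K.a * v 0 + K.b * v 1 = r * v 0 ∧ K.b * v 0 + K.c * v 1 = r * v 1) ∧ v ≠ 0 := by
  rw [Module.End.hasEigenvector_iff, Module.End.mem_eigenspace_iff]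
  refine and_congr_left fun _ => ?_
  rw [PiLp.ext_iff, Fin.forall_fin_two]
  simp [quadPart, Matrix.toLpLin_apply, dotProduct, Fin.sum_univ_two]

theorem isCenter_iff (K : Conic) {O : Plane} :
    K.IsCenter O ↔ K.a * O 0 + K.b * O 1 + K.d = 0 ∧ K.b * O 0 + K.c * O 1 + K.e = 0 := by
  rw [IsCenter, PiLp.ext_iff, Fin.forall_fin_two]
  simp [halfGrad]

theorem exists_isCenter {K : Conic} (hK : K.IsCentral) : ∃ O, K.IsCenter O := by
  have hdet : K.a * K.c - K.b * K.b ≠ 0 := by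
    simpa [IsCentral, quadPart, Matrix.det_fin_two] using hK
  obtain ⟨t, ht⟩ : ∃ t, (K.a * K.c - K.b * K.b) * t = 1 := ⟨_, mul_inv_cancel₀ hdet⟩
  refine ⟨!₂[(K.b * K.e - K.c * K.d) * t, (K.b * K.d - K.a * K.e) * t], K.isCenter_iff.2 ?_⟩
  simp only [Matrix.cons_val_zero, Matrix.cons_val_one]
  exact ⟨by linear_combination -K.d * ht, by linear_combination -K.e * ht⟩

end Conic

theorem Plane.exists_smul_of_det_eq_zero {u v : Plane} (hu : u ≠ 0)
    (h : u 0 * v 1 - u 1 * v 0 = 0) : ∃ k : ℝ, v = k • u := by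
  have hn : u 0 ^ 2 + u 1 ^ 2 ≠ 0 := by
    intro h0
    apply hu
    ext i
    fin_cases i <;> simp <;> nlinarith [sq_nonneg (u 0), sq_nonneg (u 1)]
  refine ⟨(u 0 * v 0 + u 1 * v 1) / (u 0 ^ 2 + u 1 ^ 2), ?_⟩
  ext i
  fin_cases i
  · simp; field_simp; linear_combination -u 1 * h
  · simp; field_simp; linear_combination u 0 * h

theorem Plane.inner_eq (x y : Plane) : inner ℝ x y = x 0 * y 0 + x 1 * y 1 := by
  simp [PiLp.inner_apply, Fin.sum_univ_two]; ring

theorem Plane.orthogonal_span_singleton {u v : Plane} (hu : u ≠ 0) (hv : v ≠ 0)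
    (h : u 0 * v 0 + u 1 * v 1 = 0) : (Submodule.span ℝ {v})ᗮ = Submodule.span ℝ {u} := by
  ext w
  rw [Submodule.mem_orthogonal_singleton_iff_inner_right, Submodule.mem_span_singleton,
    Plane.inner_eq]
  constructor
  · intro hw
    obtain ⟨k, hk⟩ := Plane.exists_smul_of_det_eq_zero
      (u := !₂[-v 1, v 0]) (v := u)
      (fun h0 => hv (by
        rw [PiLp.ext_iff, Fin.forall_fin_two] at h0
        ext i; fin_cases i <;> simp_all)) (by simp; linarith)
    obtain ⟨l, hl⟩ := Plane.exists_smul_of_det_eq_zero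
      (u := !₂[-v 1, v 0]) (v := w)
      (fun h0 => hv (by
        rw [PiLp.ext_iff, Fin.forall_fin_two] at h0
        ext i; fin_cases i <;> simp_all)) (by simp; linarith)
    have hk0 : k ≠ 0 := by rintro rfl; simp [hu] at hk
    exact ⟨l / k, by rw [hl, hk, smul_smul]; congr 1; field_simp⟩
  · rintro ⟨k, rfl⟩
    simp; linear_combination k * h

theorem Plane.ne_zero_iff {u : Plane} : u ≠ 0 ↔ 0 < u 0 ^ 2 + u 1 ^ 2 := by
  constructor
  · intro hu
    rw [← Fin.sum_univ_two (fun i => u i ^ 2), ← EuclideanSpace.real_norm_sq_eq]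
    positivity
  · rintro h rfl
    simp at h

/-- The hypothesis `h` says that `P' - P` is parallel to its image under the quadratic part, that
is, an eigenvector. -/
theorem Conic.exists_principalAxis_iff {K : Conic} (hK : K.IsCentral)
    (hcirc : ¬(K.b = 0 ∧ K.a = K.c)) {P P' : Plane} (hP : P ∈ K) (hne : P ≠ P')
    (h : K.b * ((P' 0 - P 0) ^ 2 - (P' 1 - P 1) ^ 2) +
      (K.c - K.a) * ((P' 0 - P 0) * (P' 1 - P 1)) = 0) :
    (∃ l : AffineSubspace ℝ Plane, K.IsPrincipalAxis l ∧ P ∈ l) ↔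
      (K.IsTangent line[ℝ, P, P'] ∨ ∃ O : Plane, K.IsCenter O ∧ O ∈ line[ℝ, P, P']) := by
  obtain ⟨u, hu⟩ : ∃ u, u = P' - P := ⟨_, rfl⟩
  have hu0 : u ≠ 0 := by rw [hu]; exact sub_ne_zero.2 hne.symm
  have hline : line[ℝ, P, P'] = AffineSubspace.mk' P (Submodule.span ℝ {u}) := by
    rw [← AffineSubspace.mk'_eq (left_mem_affineSpan_pair ℝ P P'), direction_affineSpan,
      vectorSpan_pair_rev, hu, vsub_eq_sub]
  rw [hline]
  have hdet : K.a * K.c - K.b * K.b ≠ 0 := by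
    simpa [IsCentral, quadPart, Matrix.det_fin_two] using hK
  have hE : K.b * (u 0 ^ 2 - u 1 ^ 2) + (K.c - K.a) * (u 0 * u 1) = 0 := by simpa [hu] using h
  clear h
  have quad_inj {X Y : Plane} (h0 : K.a * (X 0 - Y 0) + K.b * (X 1 - Y 1) = 0)
      (h1 : K.b * (X 0 - Y 0) + K.c * (X 1 - Y 1) = 0) : X = Y := by
    rw [PiLp.ext_iff, Fin.forall_fin_two]
    constructor <;> apply mul_left_cancel₀ hdet
    · linear_combination K.c * h0 - K.b * h1
    · linear_combination K.a * h1 - K.b * h0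
  have eig {w : Plane} (hw : w ≠ 0)
      (hE : K.b * (w 0 ^ 2 - w 1 ^ 2) + (K.c - K.a) * (w 0 * w 1) = 0) :
      ∃ r : ℝ, r ≠ 0 ∧ K.a * w 0 + K.b * w 1 = r * w 0 ∧ K.b * w 0 + K.c * w 1 = r * w 1 := by
    obtain ⟨r, hr⟩ := Plane.exists_smul_of_det_eq_zero (v := !₂[K.a * w 0 + K.b * w 1,
      K.b * w 0 + K.c * w 1]) hw (by simp; linear_combination hE)
    rw [PiLp.ext_iff, Fin.forall_fin_two] at hr
    simp at hr
    refine ⟨r, ?_, hr⟩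
    rintro rfl
    exact hw (quad_inj (by simpa using hr.1) (by simpa using hr.2))
  constructor
  · rintro ⟨l, ⟨O, v, r, hO, hv, rfl⟩, hPl⟩
    obtain ⟨⟨hv0, hv1⟩, hvne⟩ := K.hasEigenvector_iff.1 hv
    rw [AffineSubspace.mem_mk', vsub_eq_sub, Submodule.mem_span_singleton] at hPl
    obtain ⟨k, hk⟩ := hPl
    have hEv : K.b * (v 0 ^ 2 - v 1 ^ 2) + (K.c - K.a) * (v 0 * v 1) = 0 := by
      linear_combination v 0 * hv1 - v 1 * hv0
    -- `hE` and `hEv` are linear equations in `(K.b, K.c - K.a)`, nonzero by `hcirc`; their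
    -- determinant is this product, so `u` is parallel or orthogonal to `v`.
    have hdich : (u 0 * v 1 - u 1 * v 0) * (u 0 * v 0 + u 1 * v 1) = 0 := by
      by_contra hcon
      have hb : K.b = 0 := by
        apply mul_left_cancel₀ hcon
        linear_combination v 0 * v 1 * hE - u 0 * u 1 * hEv
      refine hcirc ⟨hb, ?_⟩
      have hca : K.c - K.a = 0 := by
        apply mul_left_cancel₀ hcon
        linear_combination (u 0 ^ 2 - u 1 ^ 2) * hEv - (v 0 ^ 2 - v 1 ^ 2) * hE
      linarith
    by_cases hk0 : k = 0
    · refine .inr ⟨O, hO, ?_⟩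
      rw [hk0, zero_smul, eq_comm, sub_eq_zero] at hk
      rw [hk]
      exact AffineSubspace.self_mem_mk' _ _
    rcases mul_eq_zero.1 hdich with hd | hd
    · refine .inr ⟨O, hO, ?_⟩
      obtain ⟨m, hm⟩ := Plane.exists_smul_of_det_eq_zero hu0 hd
      rw [AffineSubspace.mem_mk', vsub_eq_sub, Submodule.mem_span_singleton]
      exact ⟨-(k * m), by rw [← neg_sub P O, ← hk, hm, smul_smul, neg_smul]⟩
    · refine .inl ⟨P, hP, ?_⟩
      have hr : r ≠ 0 := by
        rintro rfl
        exact hvne (quad_inj (by simpa using hv0) (by simpa using hv1))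
      obtain ⟨hO0, hO1⟩ := K.isCenter_iff.1 hO
      rw [PiLp.ext_iff, Fin.forall_fin_two] at hk
      simp at hk
      obtain ⟨hk1, hk2⟩ := hk
      -- The half gradient at `P` is the quadratic part applied to `P - O = k • v`.
      have hg : K.halfGrad P = (k * r) • v := by
        ext i
        fin_cases i
        · simp [halfGrad]
          linear_combination hO0 + k * hv0 - K.a * hk1 - K.b * hk2
        · simp [halfGrad]
          linear_combination hO1 + k * hv1 - K.b * hk1 - K.c * hk2
      rw [tangentLine, hg, Submodule.span_singleton_smul_eq
        (IsUnit.mk0 _ (mul_ne_zero hk0 hr)), Plane.orthogonal_span_singleton hu0 hvne hd]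
  · rintro (⟨Q, hQ, hl⟩ | ⟨O, hO, hOl⟩)
    · obtain ⟨r, hr, hr0, hr1⟩ := eig hu0 hE
      have hg : u ∈ (Submodule.span ℝ {K.halfGrad Q})ᗮ := by
        have := congrArg AffineSubspace.direction hl
        rw [tangentLine, AffineSubspace.direction_mk', AffineSubspace.direction_mk'] at this
        rw [← this]
        exact Submodule.mem_span_singleton_self u
      rw [Submodule.mem_orthogonal_singleton_iff_inner_right, Plane.inner_eq] at hg
      have hQl : Q ∈ AffineSubspace.mk' P (Submodule.span ℝ {u}) := by
        rw [hl]; exact AffineSubspace.self_mem_mk' _ _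
      rw [AffineSubspace.mem_mk', vsub_eq_sub, Submodule.mem_span_singleton] at hQl
      obtain ⟨k, hk⟩ := hQl
      have hPQ : P = Q - k • u := by rw [hk]; abel
      -- On the tangent at `Q` the equation reduces to `r * ‖u‖² * k² = 0`, so the line meets `K`
      -- only at `Q`.
      have hk0 : k = 0 := by
        have h1 : K.eqn P = 0 := hP
        have h2 : K.eqn Q = 0 := hQ
        rw [hPQ] at h1
        simp [eqn, halfGrad] at h1 h2 hg
        have : (r * (u 0 ^ 2 + u 1 ^ 2)) * k ^ 2 = 0 := by
          linear_combination h1 - h2 + 2 * k * hg - k ^ 2 * (u 0 * hr0 + u 1 * hr1)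
        simpa [hr, (Plane.ne_zero_iff.1 hu0).ne'] using this
      obtain rfl : P = Q := by simpa [hk0] using hPQ
      obtain ⟨O, hO⟩ := exists_isCenter hK
      obtain ⟨hO0, hO1⟩ := K.isCenter_iff.1 hO
      -- The axis through `P` is orthogonal to the tangent: the gradient at `P` is a multiple of the
      -- eigenvector `w`, hence so is `P - O`.
      obtain ⟨w, hw⟩ : ∃ w : Plane, w = !₂[-u 1, u 0] := ⟨_, rfl⟩
      have hw0 : w 0 = -u 1 := by simp [hw]
      have hw1 : w 1 = u 0 := by simp [hw]
      have hwne : w ≠ 0 := by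
        rw [Plane.ne_zero_iff, hw0, hw1]
        linarith [Plane.ne_zero_iff.1 hu0]
      obtain ⟨r', hr', h0, h1⟩ := eig hwne (by rw [hw0, hw1]; linear_combination -hE)
      obtain ⟨s, hs⟩ := Plane.exists_smul_of_det_eq_zero (v := K.halfGrad P) hwne
        (by rw [hw0, hw1]; linear_combination -hg)
      rw [PiLp.ext_iff, Fin.forall_fin_two] at hs
      simp [halfGrad] at hs
      refine ⟨_, ⟨O, w, r', hO, K.hasEigenvector_iff.2 ⟨⟨h0, h1⟩, hwne⟩, rfl⟩, ?_⟩
      rw [AffineSubspace.mem_mk', vsub_eq_sub, Submodule.mem_span_singleton]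
      refine ⟨s * r'⁻¹, ?_⟩
      have hr'' : r' * r'⁻¹ = 1 := mul_inv_cancel₀ hr'
      apply quad_inj
      · simp
        linear_combination s * r'⁻¹ * h0 + s * w 0 * hr'' - hs.1 + hO0
      · simp
        linear_combination s * r'⁻¹ * h1 + s * w 1 * hr'' - hs.2 + hO1
    · obtain ⟨r, -, hr⟩ := eig hu0 hE
      refine ⟨_, ⟨O, u, r, hO, K.hasEigenvector_iff.2 ⟨hr, hu0⟩, rfl⟩, ?_⟩
      rw [AffineSubspace.mem_mk', vsub_eq_sub] at hOl ⊢
      rw [← neg_sub]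
      exact neg_mem hOl

/-! ### The direction of `PP'` -/

/-- In complex coordinates, isogonal conjugates `p`, `r` and a further common point `d` of the unit
circle and a conic `abcpr`. -/
theorem direction_of_conic_isogonal {a b c d p q r s α β : ℂ} (hα : α ≠ 0)
    (h₁ : p + r + a * b * c * (q * s) = a + b + c)
    (h₂ : a * b * c * (q + s) + p * r = a * b + b * c + c * a) (hp : p * q ≠ 1) (hr : r * s ≠ 1)
    (hcp : β * (p * q - 1) + α * (p ^ 2 - (a + b + c + d) * p +
      (a * b + a * c + a * d + b * c + b * d + c * d) -
      (a * b * c + a * b * d + a * c * d + b * c * d) * q + a * b * c * d * q ^ 2) = 0)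
    (hcr : β * (r * s - 1) + α * (r ^ 2 - (a + b + c + d) * r +
      (a * b + a * c + a * d + b * c + b * d + c * d) -
      (a * b * c + a * b * d + a * c * d + b * c * d) * s + a * b * c * d * s ^ 2) = 0) :
    d * (p - r) = -(a * b * c) * (q - s) := by
  rw [conic_isogonal_value h₁ h₂] at hcp
  rw [conic_isogonal_value (p := r) (r := p) (q := s) (s := q) (by linear_combination h₁)
    (by linear_combination h₂)] at hcr
  have e1 : β = α * (a * b * c * s + d * r) := by
    apply mul_left_cancel₀ (sub_ne_zero.2 hp)
    linear_combination hcp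
  have e2 : β = α * (a * b * c * q + d * p) := by
    apply mul_left_cancel₀ (sub_ne_zero.2 hr)
    linear_combination hcr
  apply mul_left_cancel₀ hα
  linear_combination e1 - e2

theorem mul_conj_eq_one_of_mem_sphere {Ω : EuclideanGeometry.Sphere Plane} (hR : Ω.radius ≠ 0)
    {X : Plane} (hX : X ∈ Ω) {z : ℂ}
    (hz : z = ⟨(X 0 - Ω.center 0) / Ω.radius, (X 1 - Ω.center 1) / Ω.radius⟩) :
    z * conj z = 1 := by
  have h : (X 0 - Ω.center 0) ^ 2 + (X 1 - Ω.center 1) ^ 2 = Ω.radius ^ 2 := by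
    rw [← EuclideanGeometry.mem_sphere.1 hX, EuclideanSpace.dist_eq, Real.sq_sqrt (by positivity),
      Fin.sum_univ_two, Real.dist_eq, Real.dist_eq, sq_abs, sq_abs]
  rw [Complex.mul_conj, hz, Complex.normSq_mk]
  norm_cast
  field_simp
  linear_combination h

open scoped Affine in
open EuclideanGeometry in
-- For `d, d'` on the unit circle, `d - d' = -d d' (conj d - conj d')`, a relation preserved by real
-- scaling; the tangent case is its limit.
theorem direction_of_chord {P P' D D' : Plane} {Ω : Sphere Plane} (hR : Ω.radius ≠ 0)
    (hne : P ≠ P') (hD : D ∈ Ω) (hD' : D' ∈ Ω)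
    (h : line[ℝ, D, D'] ∥ line[ℝ, P, P'] ∨
      (D' = D ∧ Ω.IsTangentAt D (AffineSubspace.mk' D (line[ℝ, P, P']).direction)))
    {z : Plane → ℂ} (hz : ∀ X : Plane, z X =
      ⟨(X 0 - Ω.center 0) / Ω.radius, (X 1 - Ω.center 1) / Ω.radius⟩) :
    z P - z P' = -(z D * z D') * (conj (z P) - conj (z P')) := by
  have hdir : line[ℝ, P, P'].direction = Submodule.span ℝ {P' - P} := by
    rw [direction_affineSpan, vectorSpan_pair_rev, vsub_eq_sub]
  have hd1 := mul_conj_eq_one_of_mem_sphere hR hD (hz D)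
  have hd'1 := mul_conj_eq_one_of_mem_sphere hR hD' (hz D')
  rcases h with h | ⟨rfl, h⟩
  · have h := h.direction_eq
    rw [hdir, direction_affineSpan, vectorSpan_pair_rev, vsub_eq_sub] at h
    have hDD : D' - D ≠ 0 := by
      intro h0
      rw [h0, Submodule.span_zero_singleton, eq_comm, Submodule.span_singleton_eq_bot] at h
      exact hne (sub_eq_zero.1 h).symm
    obtain ⟨k, hk⟩ := Submodule.mem_span_singleton.1
      (h ▸ Submodule.mem_span_singleton_self (P' - P) : P' - P ∈ Submodule.span ℝ {D' - D})
    rw [PiLp.ext_iff, Fin.forall_fin_two] at hk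
    simp at hk
    have hw : z P - z P' = k * (z D - z D') := by
      rw [hz, hz, hz, hz]
      apply Complex.ext <;> simp
      · linear_combination hk.1 / Ω.radius
      · linear_combination hk.2 / Ω.radius
    have hw' := congrArg conj hw
    simp at hw'
    linear_combination hw + z D * z D' * hw' + k * z D' * hd1 - k * z D * hd'1
  · have h := h.inner_left_eq_zero_of_mem (x := P' - P + D')
      (by
        rw [AffineSubspace.mem_mk', vsub_eq_sub, add_sub_cancel_right, hdir]
        exact Submodule.mem_span_singleton_self _)
    rw [vsub_eq_sub, add_sub_cancel_right, Plane.inner_eq] at h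
    simp at h
    have hw : (z P - z P') * conj (z D') + conj (z P - z P') * z D' = 0 := by
      rw [hz, hz, hz]
      apply Complex.ext <;> simp
      · linear_combination (-2) * h / Ω.radius ^ 2
      · ring
    rw [map_sub] at hw
    linear_combination z D' * hw - (z P - z P') * hd1

open scoped Affine in
open EuclideanGeometry in
/-- `Ω` is the circle `(ABC)`, `H` is the conic `(ABCPP')`, `D` is the fourth common point of `Ω`
and `H`, and `K` is the conic `(ABCD'P)`. In `hDD'`, the second alternative is the limiting case
in which the line through `D` parallel to `PP'` touches `Ω`, so that its second intersection `D'`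
with `Ω` is `D` itself. -/
theorem theorem1p3
    (A B C P P' D D' : Plane) (Ω : Sphere Plane) (H K : Conic)
    (hABC : AffineIndependent ℝ ![A, B, C])
    (hAΩ : A ∈ Ω) (hBΩ : B ∈ Ω) (hCΩ : C ∈ Ω)
    (hPP' : IsIsogonalConjugate A B C P P') (hne : P ≠ P')
    (hAH : A ∈ H) (hBH : B ∈ H) (hCH : C ∈ H) (hPH : P ∈ H) (hP'H : P' ∈ H)
    (hDΩ : D ∈ Ω) (hDH : D ∈ H) (hDA : D ≠ A) (hDB : D ≠ B) (hDC : D ≠ C)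
    (hD'Ω : D' ∈ Ω) (hD'A : D' ≠ A) (hD'B : D' ≠ B) (hD'C : D' ≠ C)
    (hDD' : line[ℝ, D, D'] ∥ line[ℝ, P, P'] ∨
      (D' = D ∧ Ω.IsTangentAt D (AffineSubspace.mk' D (line[ℝ, P, P']).direction)))
    (hAK : A ∈ K) (hBK : B ∈ K) (hCK : C ∈ K) (hD'K : D' ∈ K) (hPK : P ∈ K)
    (hK : K.IsCentral) :
    (∃ l : AffineSubspace ℝ Plane, K.IsPrincipalAxis l ∧ P ∈ l) ↔
      (K.IsTangent line[ℝ, P, P'] ∨ ∃ O : Plane, K.IsCenter O ∧ O ∈ line[ℝ, P, P']) := by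
  have hAB : A ≠ B := hABC.injective.ne (show (0 : Fin 3) ≠ 1 by decide)
  have hAC : A ≠ C := hABC.injective.ne (show (0 : Fin 3) ≠ 2 by decide)
  have hBC : B ≠ C := hABC.injective.ne (show (1 : Fin 3) ≠ 2 by decide)
  have hR : Ω.radius ≠ 0 := by
    intro h
    rw [mem_sphere, h, dist_eq_zero] at hAΩ hBΩ
    exact hAB (hAΩ.trans hBΩ.symm)
  obtain ⟨z, hz⟩ : ∃ z : Plane → ℂ, ∀ X : Plane, z X =
    ⟨(X 0 - Ω.center 0) / Ω.radius, (X 1 - Ω.center 1) / Ω.radius⟩ := ⟨_, fun _ => rfl⟩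
  have hinj {X Y : Plane} (h : X ≠ Y) : z X ≠ z Y := by
    contrapose! h
    rw [hz, hz, Complex.ext_iff] at h
    rw [PiLp.ext_iff, Fin.forall_fin_two]
    simpa [div_left_inj' hR] using h
  have hunit {X : Plane} (hX : X ∈ Ω) := mul_conj_eq_one_of_mem_sphere hR hX (hz X)
  have ha := angle_relation hPP'.angle_A hz
  have hb := angle_relation hPP'.angle_B hz
  simp only [map_sub] at ha hb
  obtain ⟨h₁, h₂⟩ := isogonal_sum (hinj hAB)
    (isogonal_at_vertex (hunit hAΩ) (hunit hBΩ) (hunit hCΩ) (hinj hAB) (hinj hAC) ha)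
    (isogonal_at_vertex (hunit hBΩ) (hunit hCΩ) (hunit hAΩ) (hinj hBC) (hinj hAB.symm) hb)
  have ne_left {X Y Q : Plane} (h : Q ∉ line[ℝ, X, Y]) : Q ≠ X := by
    rintro rfl; exact h (left_mem_affineSpan_pair _ _ _)
  have hp := not_mem_circle_of_isogonal h₁ h₂ (hinj (ne_left hPP'.left_not_mem_AB))
    (hinj (ne_left hPP'.left_not_mem_BC)) (hinj (ne_left hPP'.left_not_mem_CA))
  have hp' := not_mem_circle_of_isogonal (p := z P') (q := conj (z P')) (r := z P)
    (s := conj (z P)) (by linear_combination h₁) (by linear_combination h₂)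
    (hinj (ne_left hPP'.right_not_mem_AB)) (hinj (ne_left hPP'.right_not_mem_BC))
    (hinj (ne_left hPP'.right_not_mem_CA))
  obtain ⟨αH, βH, hαH, -, -, hH⟩ := H.complex_of_mem hR hz (hinj hAB) (hinj hAC) (hinj hDA.symm)
    (hinj hBC) (hinj hDB.symm) (hinj hDC.symm) hAH hBH hCH hDH hPH (hunit hAΩ) (hunit hBΩ)
    (hunit hCΩ) (hunit hDΩ) hp
  obtain ⟨α, -, hα, hαK, hαc, -⟩ := K.complex_of_mem hR hz (hinj hAB) (hinj hAC)
    (hinj hD'A.symm) (hinj hBC) (hinj hD'B.symm) (hinj hD'C.symm) hAK hBK hCK hD'K hPK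
    (hunit hAΩ) (hunit hBΩ) (hunit hCΩ) (hunit hD'Ω) hp
  have hdir := direction_of_conic_isogonal hαH h₁ h₂ hp hp' (hH P hPH) (hH P' hP'H)
  have hchord := direction_of_chord hR hne hDΩ hD'Ω hDD' hz
  have hreal : α * (z P - z P') ^ 2 = conj (α * (z P - z P') ^ 2) := by
    rw [map_mul, map_pow, map_sub, hαc]
    linear_combination α * (z P - z P') * hchord -
      α * z D' * (conj (z P) - conj (z P')) * hdir
  refine K.exists_principalAxis_iff hK ?_ hPK hne ?_
  · rintro ⟨h0, h1⟩
    exact hα (by rw [hαK, h0, h1]; apply Complex.ext <;> simp)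
  -- Up to a nonzero real factor, the imaginary part of `α (p - r)²` is the eigenvector condition.
  · have := congrArg Complex.im hreal
    rw [hαK, hz, hz] at this
    simp [pow_two] at this
    field_simp at this
    linear_combination -this / 8
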